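/- For a symmetric real $n\times n$ matrix $J$ with zero diagonal, the Ising model with interaction matrix $J$ is the probability measure on $\{-1,1\}^n$ with $\pi(x)\propto\exp(\tfrac12 x^{\top}Jx)$. Let $A$ be the adjacency matrix of the complete graph on $n$ nodes and let $B$ be the adjacency matrix of a $d$-regular simple graph $G$ on $n$ nodes, $d\ge 1$; let $\lambda_2,\dots,\lambda_n$ be the eigenvalues of $B$ (with multiplicity) on the orthogonal complement of the all-ones vector. For $\epsilon\in(0,1)$, $G$ is an $\epsilon$-expander if $|\lambda_i|\le\epsilon d$ for $i=2,\dots,n$. For $\delta\ge0$, $G$ is $\delta$-approximately Ramanujan if $|\lambda_i|\le 2(\sqrt{d-1}+\delta)$ for $i=2,\dots,n$. Let $\mu$ (the Curie-Weiss model) and $\nu$ be the Ising models with interaction matrices $\frac{\beta}{n}A$ and $\frac{\beta}{d}B$. For a set $R$ of $k$ nodes put $\rho^{(k)}[R]=\mathbb E_\mu\prod_{i\in R}x^i$ and $\tilde\rho^{(k)}[R]=\mathbb E_\nu\prod_{i\in R}x^i$, and let $\rho_{ij}=\mathbb E_\mu x^ix^j$, $\tilde\rho_{ij}=\mathbb E_\nu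 x^ix^j$. **Theorem.** For every $\beta>1$ there are positive constants $\epsilon_0(\beta)$ and $C(\beta)$, depending only on $\beta$, such that the following holds for all $n$ and $d\ge1$. (1) If $G$ is a $d$-regular $\epsilon$-expander on $n$ nodes with $\epsilon<\epsilon_0(\beta)$, then for every even positive integer $k<n$ $$\frac1{\binom nk}\sum_{|R|=k}\bigl|\rho^{(k)}[R]-\tilde\rho^{(k)}[R]\bigr|\le k\,C(\beta)\Bigl(\epsilon+\frac1n\Bigr),$$ and in particular $$\frac1{\binom n2}\sum_{i<j}|\rho_{ij}-\tilde\rho_{ij}|<2\,C(\beta)\Bigl(\epsilon+\frac1n\Bigr).$$ (2) If $G$ is a $d$-regular $\delta$-approximately Ramanujan graph on $n$ nodes, $\delta\ge0$, then for every even positive integer $k<n$ $$\frac1{\binom nk}\sum_{|R|=k}\bigl|\rho^{(k)}[R]-\tilde\rho^{(k)}[R]\bigr|\le \frac{k\,C(\beta)(1+\delta)}{\sqrt d}.$$ -/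

import Mathlib

noncomputable section

namespace IsingMoments

/-- Spin configurations in `{-1, 1}^n`; `ℤˣ` has exactly the two elements `1` and `-1`. -/
abbrev Config (n : ℕ) : Type := Fin n → ℤˣ

/-- A configuration as a real vector with entries `±1`. -/
def spin {n : ℕ} (x : Config n) : Fin n → ℝ := fun i => ((x i : ℤ) : ℝ)

/-- The Hamiltonian `H_J(x) = (1/2) xᵀ J x`. -/
def hamiltonian {n : ℕ} (J : Matrix (Fin n) (Fin n) ℝ) (x : Config n) : ℝ :=
  (1 / 2) * (spin x ⬝ᵥ J.mulVec (spin x))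

/-- The partition function of the Ising model with interaction matrix `J`. -/
def partitionFunction {n : ℕ} (J : Matrix (Fin n) (Fin n) ℝ) : ℝ :=
  ∑ x : Config n, Real.exp (hamiltonian J x)

/-- The probability of the configuration `x` in the Ising model with interaction matrix `J`. -/
def isingProb {n : ℕ} (J : Matrix (Fin n) (Fin n) ℝ) (x : Config n) : ℝ :=
  Real.exp (hamiltonian J x) / partitionFunction J

theorem partitionFunction_pos {n : ℕ} (J : Matrix (Fin n) (Fin n) ℝ) :
    0 < partitionFunction J :=
  Finset.sum_pos (fun _ _ => Real.exp_pos _) Finset.univ_nonempty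

theorem isingProb_pos {n : ℕ} (J : Matrix (Fin n) (Fin n) ℝ) (x : Config n) :
    0 < isingProb J x :=
  div_pos (Real.exp_pos _) (partitionFunction_pos J)

theorem sum_isingProb {n : ℕ} (J : Matrix (Fin n) (Fin n) ℝ) :
    ∑ x : Config n, isingProb J x = 1 := by
  unfold isingProb
  rw [← Finset.sum_div]
  exact div_self (partitionFunction_pos J).ne'

/-- Expectation under the Ising model with interaction matrix `J`. -/
def isingExpectation {n : ℕ} (J : Matrix (Fin n) (Fin n) ℝ) (f : Config n → ℝ) : ℝ :=
  ∑ x : Config n, isingProb J x * f x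

/-- The moment `E[∏_{i ∈ R} x^i]`, of order `|R|`. -/
def moment {n : ℕ} (J : Matrix (Fin n) (Fin n) ℝ) (R : Finset (Fin n)) : ℝ :=
  isingExpectation J fun x => ∏ i ∈ R, spin x i

/-- The pairwise correlation `E[x^i x^j]`. -/
def pairCorrelation {n : ℕ} (J : Matrix (Fin n) (Fin n) ℝ) (i j : Fin n) : ℝ :=
  isingExpectation J fun x => spin x i * spin x j

/-- Interaction matrix `(β / n) A` of the Curie-Weiss model, with `A` the adjacency matrix of the
complete graph on `n` nodes. -/
def curieWeissMatrix (n : ℕ) (β : ℝ) : Matrix (Fin n) (Fin n) ℝ :=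
  (β / n) • (⊤ : SimpleGraph (Fin n)).adjMatrix ℝ

/-- Interaction matrix `(β / d) B`, with `B` the adjacency matrix of `G`. -/
def graphMatrix {n : ℕ} (G : SimpleGraph (Fin n)) [DecidableRel G.Adj] (d : ℕ) (β : ℝ) :
    Matrix (Fin n) (Fin n) ℝ :=
  (β / d) • G.adjMatrix ℝ

/-- `G` is regular of degree `d ≥ 1` and the eigenvalues `λ₂, …, λₙ` of its adjacency matrix,
those with eigenvectors orthogonal to the all-ones vector, are at most `r` in absolute value.
(If the eigenvalue `d` has multiplicity at least two, it occurs among these.) -/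
def IsRegularWithSpectralBound {n : ℕ} (G : SimpleGraph (Fin n)) [DecidableRel G.Adj]
    (d : ℕ) (r : ℝ) : Prop :=
  0 < d ∧ G.IsRegularOfDegree d ∧
    ∀ (v : Fin n → ℝ) (lam : ℝ), v ≠ 0 → v ⬝ᵥ 1 = 0 →
      (G.adjMatrix ℝ).mulVec v = lam • v → |lam| ≤ r

/-- `d`-regular `ε`-expanders, `ε ∈ (0, 1)`. -/
def IsExpander {n : ℕ} (G : SimpleGraph (Fin n)) [DecidableRel G.Adj] (d : ℕ) (ε : ℝ) : Prop :=
  0 < ε ∧ ε < 1 ∧ IsRegularWithSpectralBound G d (ε * d)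

/-- `d`-regular `δ`-approximately Ramanujan graphs: the expansion parameter is
`2 (√(d - 1) + δ) / d` (that is, `|λᵢ| ≤ 2 (√(d - 1) + δ)`), which need not be smaller than one
when `d` is small. -/
def IsApproxRamanujan {n : ℕ} (G : SimpleGraph (Fin n)) [DecidableRel G.Adj]
    (d : ℕ) (δ : ℝ) : Prop :=
  IsRegularWithSpectralBound G d (2 * (Real.sqrt ((d : ℝ) - 1) + δ))

/-- The average of `|ρ^{(k)}[R] - ρ̃^{(k)}[R]|` over all `k`-subsets `R` of the nodes, for the Ising
models with interaction matrices `J` and `K`. -/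
def avgMomentError {n : ℕ} (J K : Matrix (Fin n) (Fin n) ℝ) (k : ℕ) : ℝ :=
  1 / (n.choose k : ℝ) *
    ∑ R ∈ Finset.powersetCard k (Finset.univ : Finset (Fin n)), |moment J R - moment K R|

/-- The average of `|ρ_{ij} - ρ̃_{ij}|` over all pairs `i < j`. -/
def avgPairError {n : ℕ} (J K : Matrix (Fin n) (Fin n) ℝ) : ℝ :=
  1 / (n.choose 2 : ℝ) *
    ∑ j : Fin n, ∑ i ∈ Finset.univ.filter (fun i : Fin n => i < j),
      |pairCorrelation J i j - pairCorrelation K i j|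

end IsingMoments

end

noncomputable section

namespace IsingMoments

open Real

/-! Both models are compared with one number, `m ^ k`, where `m > 0` solves `m = tanh (β m)`. All
that is used of an interaction matrix is `IsNearMeanField`: for every configuration `x` the local
fields are, on average over the sites, within `η` of `β M`, where `M` is the magnetization of `x`.
For Curie-Weiss `η = β / n`; for a graph with spectral bound `r` it is `β r / d`, by an operator
norm bound and Cauchy-Schwarz.

Given the other spins, a spin has mean `tanh` of its local field. Hence `E[(M - tanh (β M)) φ]` is
at most `η` plus the change of `φ` under one spin flip, for every `φ` bounded by 1
(`abs_isingExpectation_magnetization_sub_tanh_le`). Applied to a smoothed sign of `M`, this makes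
the expected drift of `|M|` of order `η + 1/n`; applied to that sign times `|M| - m`, it does the
same for `E(|M| - m)²`. The repelling fixed point `0` is excluded separately: a tilted lower bound
on the partition function makes small `|M|` exponentially unlikely.

Expanding `tanh (β M) ^ k` at `m`, the linear term is a multiple of the drift and the remainder is
quadratic, so the error is `O(k (η + 1/n))` rather than its square root. Finally, the spins in a
moment are replaced by `tanh (β M)` one at a time; the single-site errors become small after
averaging over `R`. -/

/-! ### Calculus of the hyperbolic functions. -/

theorem hasDerivAt_tanh (x : ℝ) : HasDerivAt tanh (1 - tanh x ^ 2) x := by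
  have h := (hasDerivAt_sinh x).div (hasDerivAt_cosh x) (cosh_pos x).ne'
  have hc := (cosh_pos x).ne'
  have e : tanh = sinh / cosh := by
    ext y
    exact tanh_eq_sinh_div_cosh y
  rw [← e] at h
  refine h.congr_deriv ?_
  rw [tanh_eq_sinh_div_cosh]
  field_simp

theorem continuous_tanh : Continuous tanh :=
  continuous_iff_continuousAt.2 fun x => (hasDerivAt_tanh x).continuousAt

theorem deriv_tanh (x : ℝ) : deriv tanh x = 1 - tanh x ^ 2 := (hasDerivAt_tanh x).deriv

theorem differentiable_tanh : Differentiable ℝ tanh := fun x => (hasDerivAt_tanh x).differentiableAt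

theorem monotone_tanh : Monotone tanh :=
  monotone_of_deriv_nonneg differentiable_tanh fun x => by
    rw [deriv_tanh]
    linarith [tanh_sq_lt_one x]

theorem tanh_nonneg {x : ℝ} (hx : 0 ≤ x) : 0 ≤ tanh x := by
  simpa using monotone_tanh hx

theorem abs_tanh_sub_le (x y : ℝ) : |tanh x - tanh y| ≤ |x - y| := by
  have h := Convex.norm_image_sub_le_of_norm_deriv_le (f := tanh) (C := 1) (s := Set.univ)
    (x := y) (y := x) (fun z _ => differentiable_tanh z) (fun z _ => by
      rw [deriv_tanh, norm_eq_abs, abs_le]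
      constructor <;> nlinarith [tanh_sq_lt_one z, sq_nonneg (tanh z)])
    convex_univ trivial trivial
  simpa using h

theorem abs_tanh_le (x : ℝ) : |tanh x| ≤ |x| := by
  simpa using abs_tanh_sub_le x 0

theorem tanh_abs (x : ℝ) : tanh |x| = |tanh x| := by
  rcases le_total 0 x with h | h
  · rw [abs_of_nonneg h, abs_of_nonneg (tanh_nonneg h)]
  · have := tanh_nonneg (neg_nonneg.2 h)
    rw [tanh_neg] at this
    rw [abs_of_nonpos h, tanh_neg, abs_of_nonpos (by linarith)]

theorem concaveOn_tanh : ConcaveOn ℝ (Set.Ici 0) tanh := by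
  refine AntitoneOn.concaveOn_of_deriv (convex_Ici 0) continuous_tanh.continuousOn
    differentiable_tanh.differentiableOn ?_
  intro x hx y hy hxy
  rw [interior_Ici] at hx hy
  rw [deriv_tanh, deriv_tanh]
  have h1 := tanh_nonneg (le_of_lt hx)
  have h2 := monotone_tanh hxy
  nlinarith

theorem sub_sq_le_tanh {x : ℝ} (hx : 0 ≤ x) : x - x ^ 2 ≤ tanh x := by
  have hd : ∀ y : ℝ, HasDerivAt (fun y => tanh y - (y - y ^ 2)) (1 - tanh y ^ 2 - (1 - 2 * y)) y := by
    intro y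
    refine (hasDerivAt_tanh y).sub ((hasDerivAt_id y).sub ?_)
    simpa using hasDerivAt_pow 2 y
  have hm : MonotoneOn (fun y => tanh y - (y - y ^ 2)) (Set.Ici 0) := by
    refine monotoneOn_of_deriv_nonneg (convex_Ici 0)
      (fun y _ => (hd y).continuousAt.continuousWithinAt)
      (fun y _ => (hd y).differentiableAt.differentiableWithinAt) ?_
    intro y hy
    rw [interior_Ici] at hy
    have hy0 : 0 < y := hy
    rw [(hd y).deriv]
    have h1 := tanh_nonneg hy0.le
    have h2 := abs_tanh_le y
    rw [abs_of_nonneg h1, abs_of_nonneg hy0.le] at h2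
    nlinarith [tanh_lt_one y]
  have := hm (Set.mem_Ici.2 le_rfl) (Set.mem_Ici.2 hx) hx
  simp at this
  linarith

theorem abs_tanh_sub_self_le (x : ℝ) : |tanh x - x| ≤ x ^ 2 := by
  wlog hx : 0 ≤ x generalizing x
  · have := this (-x) (by linarith)
    rw [tanh_neg, abs_sub_comm] at this
    rw [neg_sq] at this
    convert this using 2
    ring
  have h1 := sub_sq_le_tanh hx
  have h2 := abs_tanh_le x
  rw [abs_of_nonneg (tanh_nonneg hx), abs_of_nonneg hx] at h2
  rw [abs_le]
  constructor <;> nlinarith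

theorem tanh_sub_tanh (x y : ℝ) : tanh x - tanh y = tanh (x - y) * (1 - tanh x * tanh y) := by
  have hx := (cosh_pos x).ne'
  have hy := (cosh_pos y).ne'
  have hxy := cosh_pos (x - y)
  rw [cosh_sub] at hxy
  simp only [tanh_eq_sinh_div_cosh, sinh_sub, cosh_sub]
  have := hxy.ne'
  field_simp

/-- Multiplied by `cosh y ^ 2` this is `y < sinh y * cosh y`. At `y = β m` it shows that `tanh (β
u)` has slope less than one at its positive fixed point. -/
theorem mul_one_sub_tanh_sq_lt {y : ℝ} (hy : 0 < y) : y * (1 - tanh y ^ 2) < tanh y := by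
  have hc := cosh_pos y
  have h1 : y < sinh y := self_lt_sinh_iff.2 hy
  have h2 := one_le_cosh y
  have h3 : 1 - tanh y ^ 2 = 1 / cosh y ^ 2 := by
    rw [tanh_eq_sinh_div_cosh]
    field_simp
    linarith [cosh_sq y]
  rw [h3, tanh_eq_sinh_div_cosh, mul_one_div, div_lt_div_iff₀ (by positivity) hc]
  nlinarith [mul_le_mul h2 h2 zero_le_one hc.le, mul_pos hc (sub_pos.2 h1), mul_nonneg (sub_nonneg.2 h2) (mul_pos hc (hy.trans h1)).le]

theorem one_add_sq_div_two_le_cosh (y : ℝ) : 1 + y ^ 2 / 2 ≤ cosh y := by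
  have h : cosh y = 1 + 2 * sinh (y / 2) ^ 2 := by
    have := cosh_two_mul (y / 2)
    rw [mul_div_cancel₀ _ (two_ne_zero)] at this
    rw [this, cosh_sq]
    ring
  have h2 : |y / 2| ≤ |sinh (y / 2)| := by
    rcases le_total 0 (y / 2) with h | h
    · rw [abs_of_nonneg h]
      exact (self_le_sinh_iff.2 h).trans (le_abs_self _)
    · rw [abs_of_nonpos h]
      have := sinh_le_self_iff.2 h
      linarith [neg_le_abs (sinh (y / 2))]
  have := sq_le_sq.2 h2
  rw [h]
  linarith

/-! ### The mean-field equation for `β > 1`. -/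

/-- The exponential growth rate gained by tilting the uniform measure is positive for `β > 1`. -/
theorem exists_tilt {β : ℝ} (hβ : 1 < β) :
    ∃ θ κ : ℝ, 0 < κ ∧ exp (β * θ ^ 2 / 2 + κ) ≤ cosh (β * θ) := by
  obtain ⟨z, hz0, hz1, hzβ⟩ : ∃ z : ℝ, 0 < z ∧ z ≤ 1 ∧ z < β - 1 :=
    ⟨min 1 ((β - 1) / 2), lt_min one_pos (by linarith), min_le_left _ _,
      (min_le_right _ _).trans_lt (by linarith)⟩
  have hβ0 : 0 < β := by linarith
  -- With `z = β θ² / 2` the quadratic bound on `cosh (β θ)` is `1 + β z`, and `exp z ≤ 1 + z + z² <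
  -- 1 + β z` because `z < β - 1`.
  refine ⟨√(2 * z / β), log (1 + β * z) - z, ?_, ?_⟩
  · have h := abs_exp_sub_one_sub_id_le (x := z) (by rw [abs_of_pos hz0]; exact hz1)
    have h1 := (abs_le.1 h).2
    rw [sub_pos, lt_log_iff_exp_lt (by positivity)]
    nlinarith
  · have hs : √(2 * z / β) ^ 2 = 2 * z / β := sq_sqrt (by positivity)
    have e1 : β * √(2 * z / β) ^ 2 / 2 + (log (1 + β * z) - z) = log (1 + β * z) := by
      rw [hs]
      field_simp
      ring
    rw [e1, exp_log (by positivity)]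
    have := one_add_sq_div_two_le_cosh (β * √(2 * z / β))
    rw [mul_pow, hs] at this
    convert this using 1
    field_simp

/-- The spontaneous magnetization `m`, with a level `c < m` above which the drift `u - tanh (β u)`
pushes linearly towards `m`. -/
theorem exists_magnetization {β b : ℝ} (hβ : 1 < β) (hb : 0 < b) :
    ∃ c m r : ℝ, 0 < c ∧ c ≤ b ∧ c < m ∧ m < 1 ∧ tanh (β * m) = m ∧ β * (1 - m ^ 2) < 1 ∧ 0 < r ∧
      ∀ u, c ≤ u → r * (u - m) ^ 2 ≤ (u - tanh (β * u)) * (u - m) := by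
  have hβ0 : 0 < β := by linarith
  obtain ⟨c, hc0, hcb, hc1, hc⟩ : ∃ c : ℝ, 0 < c ∧ c ≤ b ∧ c < 1 ∧ c < tanh (β * c) := by
    -- By `x - x² ≤ tanh x`, the inequality `c < tanh (β c)` holds as soon as `c < (β - 1) / β²`;
    -- half of this is taken.
    refine ⟨min b (min (1 / 2) ((β - 1) / (2 * β ^ 2))), ?_, min_le_left _ _, ?_, ?_⟩
    · have : 0 < (β - 1) / (2 * β ^ 2) := div_pos (by linarith) (by positivity)
      positivity
    · exact ((min_le_right _ _).trans (min_le_left _ _)).trans_lt (by norm_num)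
    · set c := min b (min (1 / 2) ((β - 1) / (2 * β ^ 2))) with hcdef
      have hpos : 0 < (β - 1) / (2 * β ^ 2) := div_pos (by linarith) (by positivity)
      have hc0 : 0 < c := by positivity
      have hle : c ≤ (β - 1) / (2 * β ^ 2) := (min_le_right _ _).trans (min_le_right _ _)
      rw [le_div_iff₀ (by positivity)] at hle
      have h := sub_sq_le_tanh (x := β * c) (by positivity)
      nlinarith
  have hcont : Continuous fun u : ℝ => u - tanh (β * u) :=
    continuous_id.sub (continuous_tanh.comp (continuous_const.mul continuous_id))
  obtain ⟨m, ⟨hcm, hm1⟩, hm⟩ : (0 : ℝ) ∈ (fun u : ℝ => u - tanh (β * u)) '' Set.Ioo c 1 := by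
    refine intermediate_value_Ioo hc1.le hcont.continuousOn ⟨by linarith, ?_⟩
    have := tanh_lt_one (β * 1)
    linarith
  have hTm : tanh (β * m) = m := by
    have : m - tanh (β * m) = 0 := hm
    linarith
  have hm0 : 0 < m := hc0.trans hcm
  have hconc : ConcaveOn ℝ (Set.Ici 0) fun u : ℝ => tanh (β * u) := by
    have := concaveOn_tanh.comp_linearMap (LinearMap.mulLeft ℝ β)
    refine (this.subset ?_ (convex_Ici 0))
    intro u hu
    have hu0 : (0 : ℝ) ≤ u := hu
    simp only [Set.mem_preimage, LinearMap.mulLeft_apply, Set.mem_Ici]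
    positivity
  -- Here `r` is one minus the slope of the secant of `tanh (β u)` from `c` to `m`. That slope is
  -- below one since `tanh (β c) > c`, and by concavity it bounds the secant slopes from `m` to
  -- every `u ≥ c`.
  refine ⟨c, m, 1 - (tanh (β * c) - m) / (c - m), hc0, hcb, hcm, hm1, hTm, ?_, ?_, ?_⟩
  · have := mul_one_sub_tanh_sq_lt (y := β * m) (by positivity)
    rw [hTm] at this
    by_contra hcon
    push Not at hcon
    nlinarith
  · rw [sub_pos, div_lt_one_of_neg (by linarith)]
    linarith
  · intro u hu
    rcases eq_or_ne u m with rfl | hne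
    · simp
    have hsec := hconc.neg.secant_mono (a := m) (x := c) (y := u) hm0.le hc0.le (hc0.le.trans hu)
      hcm.ne hne hu
    replace hsec : (tanh (β * u) - m) / (u - m) ≤ (tanh (β * c) - m) / (c - m) := by
      simp only [Pi.neg_apply, hTm, neg_sub_neg] at hsec
      rw [← neg_le_neg_iff, ← neg_div, ← neg_div, neg_sub, neg_sub]
      exact hsec
    have hsq : 0 < (u - m) ^ 2 := by
      have := sub_ne_zero.2 hne
      positivity
    have h3 : (tanh (β * u) - m) * (u - m) ≤ (tanh (β * c) - m) / (c - m) * (u - m) ^ 2 := by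
      calc (tanh (β * u) - m) * (u - m) = (tanh (β * u) - m) / (u - m) * (u - m) ^ 2 := by
            have := sub_ne_zero.2 hne
            field_simp
        _ ≤ _ := mul_le_mul_of_nonneg_right hsec hsq.le
    nlinarith

/-! ### Taylor estimates uniform in the exponent. -/

/-- A uniform bound for the derivative of `s ↦ s ^ l` on `[0, t]`, `t < 1`. -/
theorem exists_mul_pow_pred_bound {t : ℝ} (ht0 : 0 ≤ t) (ht1 : t < 1) :
    ∃ K : ℝ, 0 ≤ K ∧ ∀ l : ℕ, l * t ^ (l - 1) ≤ K := by
  have hs := tendsto_self_mul_const_pow_of_lt_one ht0 ht1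
  obtain ⟨K, hK⟩ := hs.bddAbove_range
  have hK' : ∀ l : ℕ, l * t ^ l ≤ K := fun l => hK ⟨l, rfl⟩
  have hK0 : 0 ≤ K := by simpa using hK' 0
  refine ⟨K + 1, by linarith, fun l => ?_⟩
  cases l with
  | zero => simpa using by linarith
  | succ l =>
    have := hK' l
    have h1 : t ^ l ≤ 1 := pow_le_one₀ ht0 ht1.le
    push_cast
    linarith

theorem abs_pow_sub_pow_le_mul {t K a b : ℝ} (hK : ∀ l : ℕ, l * t ^ (l - 1) ≤ K)
    (ha : |a| ≤ t) (hb : |b| ≤ t) (l : ℕ) : |a ^ l - b ^ l| ≤ K * |a - b| := by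
  have h := abs_pow_sub_pow_le a b l
  have h1 : max |a| |b| ^ (l - 1) ≤ t ^ (l - 1) :=
    pow_le_pow_left₀ (le_max_of_le_left (abs_nonneg a)) (max_le ha hb) _
  calc _ ≤ |a - b| * l * max |a| |b| ^ (l - 1) := h
    _ ≤ |a - b| * l * t ^ (l - 1) := by gcongr
    _ = (l * t ^ (l - 1)) * |a - b| := by ring
    _ ≤ _ := mul_le_mul_of_nonneg_right (hK l) (abs_nonneg _)

/-- Each increase of `k` adds only `(b - a) * (b ^ k - a ^ k)`, which is at most `K (b - a)²` with
`K` independent of `k`. So the constant grows linearly in `k`, as the factor `k` in the theorem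
requires. -/
theorem abs_pow_taylor_le {t K a b : ℝ} (hK : ∀ l : ℕ, l * t ^ (l - 1) ≤ K) (ht : t ≤ 1)
    (ha : |a| ≤ t) (hb : |b| ≤ t) (k : ℕ) :
    |b ^ k - a ^ k - k * a ^ (k - 1) * (b - a)| ≤ k * K * (b - a) ^ 2 := by
  induction k with
  | zero => simp
  | succ k ih =>
    have e : b ^ (k + 1) - a ^ (k + 1) - ((k + 1 : ℕ) : ℝ) * a ^ (k + 1 - 1) * (b - a) =
        a * (b ^ k - a ^ k - k * a ^ (k - 1) * (b - a)) + (b - a) * (b ^ k - a ^ k) := by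
      cases k with
      | zero => simp
      | succ k =>
        simp only [Nat.add_sub_cancel]
        push_cast
        ring
    rw [e]
    refine (abs_add_le _ _).trans ?_
    rw [abs_mul, abs_mul]
    have h1 := abs_pow_sub_pow_le_mul hK hb ha k
    have h2 : |a| * |b ^ k - a ^ k - k * a ^ (k - 1) * (b - a)| ≤ 1 * (k * K * (b - a) ^ 2) :=
      mul_le_mul (ha.trans ht) ih (abs_nonneg _) zero_le_one
    have h3 := mul_le_mul_of_nonneg_left h1 (abs_nonneg (b - a))
    have h4 : |b - a| * |b - a| = (b - a) ^ 2 := by rw [← sq, sq_abs]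
    have h5 : |b - a| * (K * |b - a|) = K * (b - a) ^ 2 := by rw [← h4]; ring
    push_cast
    linarith

/-- Second-order expansion of `tanh (β u)` at a fixed point. -/
theorem abs_tanh_taylor_le {β m : ℝ} (hm : tanh (β * m) = m) (u : ℝ) :
    |tanh (β * u) - m - β * (1 - m ^ 2) * (u - m)| ≤ 2 * β ^ 2 * (u - m) ^ 2 := by
  have h1 := tanh_sub_tanh (β * u) (β * m)
  have h2 := abs_tanh_sub_self_le (β * u - β * m)
  have h3 := abs_tanh_sub_le (β * u) (β * m)
  have h4 := abs_tanh_le (β * u - β * m)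
  rw [hm] at h1 h3
  -- The subtraction formula has the factor `1 - m tanh (β u) = (1 - m²) - m (tanh (β u) - m)`; its
  -- second part contributes a quadratic term.
  have e : tanh (β * u) - m - β * (1 - m ^ 2) * (u - m) =
      (tanh (β * u - β * m) - (β * u - β * m)) * (1 - m ^ 2) -
        m * (tanh (β * u - β * m) * (tanh (β * u) - m)) := by
    linear_combination h1
  have hmsq : m ^ 2 < 1 := by
    have := tanh_sq_lt_one (β * m)
    rwa [hm] at this
  have hm1 : |m| ≤ 1 := abs_le_one_iff_mul_self_le_one.2 (by nlinarith)
  rw [e]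
  refine (abs_sub _ _).trans ?_
  have h5 : |(tanh (β * u - β * m) - (β * u - β * m)) * (1 - m ^ 2)| ≤ (β * u - β * m) ^ 2 * 1 := by
    rw [abs_mul]
    refine mul_le_mul h2 ?_ (abs_nonneg _) (sq_nonneg _)
    rw [abs_le]
    constructor <;> nlinarith [sq_nonneg m]
  have h6 : |m * (tanh (β * u - β * m) * (tanh (β * u) - m))| ≤
      1 * (|β * u - β * m| * |β * u - β * m|) := by
    rw [abs_mul, abs_mul]
    gcongr
  rw [← sq, sq_abs] at h6
  have : (β * u - β * m) ^ 2 = β ^ 2 * (u - m) ^ 2 := by ring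
  rw [this] at h5 h6
  linarith

open Finset

variable {n : ℕ}

/-! ### Expectations -/

theorem isingExpectation_add (J : Matrix (Fin n) (Fin n) ℝ) (f g : Config n → ℝ) :
    isingExpectation J (fun x => f x + g x) = isingExpectation J f + isingExpectation J g := by
  simp only [isingExpectation, mul_add, sum_add_distrib]

theorem isingExpectation_sub (J : Matrix (Fin n) (Fin n) ℝ) (f g : Config n → ℝ) :
    isingExpectation J (fun x => f x - g x) = isingExpectation J f - isingExpectation J g := by
  simp only [isingExpectation, mul_sub, sum_sub_distrib]

theorem isingExpectation_const_mul (J : Matrix (Fin n) (Fin n) ℝ) (a : ℝ) (f : Config n → ℝ) :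
    isingExpectation J (fun x => a * f x) = a * isingExpectation J f := by
  simp only [isingExpectation, mul_sum]
  exact sum_congr rfl fun x _ => by ring

theorem isingExpectation_sum {ι : Type*} (J : Matrix (Fin n) (Fin n) ℝ) (s : Finset ι)
    (f : ι → Config n → ℝ) :
    isingExpectation J (fun x => ∑ i ∈ s, f i x) = ∑ i ∈ s, isingExpectation J (f i) := by
  simp only [isingExpectation, mul_sum]
  exact sum_comm

theorem isingExpectation_const (J : Matrix (Fin n) (Fin n) ℝ) (a : ℝ) :
    isingExpectation J (fun _ => a) = a := by
  rw [isingExpectation, ← sum_mul, sum_isingProb, one_mul]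

theorem isingExpectation_mono (J : Matrix (Fin n) (Fin n) ℝ) {f g : Config n → ℝ}
    (h : ∀ x, f x ≤ g x) : isingExpectation J f ≤ isingExpectation J g :=
  sum_le_sum fun x _ => mul_le_mul_of_nonneg_left (h x) (isingProb_pos J x).le

theorem abs_isingExpectation_le (J : Matrix (Fin n) (Fin n) ℝ) {f g : Config n → ℝ}
    (h : ∀ x, |f x| ≤ g x) : |isingExpectation J f| ≤ isingExpectation J g := by
  refine (abs_sum_le_sum_abs _ _).trans (sum_le_sum fun x _ => ?_)
  rw [abs_mul, abs_of_pos (isingProb_pos J x)]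
  exact mul_le_mul_of_nonneg_left (h x) (isingProb_pos J x).le

/-! ### Spins -/

theorem spin_eq_one_or (x : Config n) (i : Fin n) : spin x i = 1 ∨ spin x i = -1 := by
  rcases Int.units_eq_one_or (x i) with h | h <;> simp [spin, h]

theorem abs_spin (x : Config n) (i : Fin n) : |spin x i| = 1 := by
  rcases spin_eq_one_or x i with h | h <;> simp [h]

theorem spin_sq (x : Config n) (i : Fin n) : spin x i ^ 2 = 1 := by
  rcases spin_eq_one_or x i with h | h <;> simp [h]

theorem abs_prod_spin (x : Config n) (R : Finset (Fin n)) : |∏ i ∈ R, spin x i| = 1 := by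
  rw [abs_prod]
  exact prod_eq_one fun i _ => abs_spin x i

theorem abs_moment_le_one (J : Matrix (Fin n) (Fin n) ℝ) (R : Finset (Fin n)) :
    |moment J R| ≤ 1 := by
  have := abs_isingExpectation_le J (f := fun x => ∏ i ∈ R, spin x i) (g := fun _ => 1)
    fun x => (abs_prod_spin x R).le
  rwa [isingExpectation_const] at this

/-- The magnetization, i.e. the average spin. -/
def magnetization (x : Config n) : ℝ := (∑ i, spin x i) / n

theorem card_mul_magnetization (x : Config n) : (n : ℝ) * magnetization x = ∑ i, spin x i := by
  rcases Nat.eq_zero_or_pos n with rfl | hn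
  · simp
  · have : (n : ℝ) ≠ 0 := by positivity
    rw [magnetization]
    field_simp

theorem abs_magnetization_le_one (x : Config n) : |magnetization x| ≤ 1 := by
  rw [magnetization, abs_div, Nat.abs_cast]
  refine div_le_one_of_le₀ ((abs_sum_le_sum_abs _ _).trans ?_) (by positivity)
  simp [abs_spin]

/-- Reversal of the spin at `i`. -/
def flip (i : Fin n) (x : Config n) : Config n := Function.update x i (-x i)

theorem flip_flip (i : Fin n) (x : Config n) : flip i (flip i x) = x := by
  simp [flip]

theorem spin_flip (i : Fin n) (x : Config n) :
    spin (flip i x) = spin x - Pi.single i (2 * spin x i) := by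
  ext j
  rcases eq_or_ne j i with rfl | h
  · simp [spin, flip]
    ring
  · simp [spin, flip, h]

theorem spin_flip_self (i : Fin n) (x : Config n) : spin (flip i x) i = -spin x i := by
  rw [spin_flip]
  simp
  ring

theorem spin_flip_of_ne {i j : Fin n} (h : j ≠ i) (x : Config n) :
    spin (flip i x) j = spin x j := by
  rw [spin_flip]
  simp [h]

theorem abs_magnetization_sub_flip (i : Fin n) (x : Config n) :
    |magnetization x - magnetization (flip i x)| = 2 / n := by
  have : magnetization x - magnetization (flip i x) = 2 * spin x i / n := by
    rw [magnetization, magnetization, spin_flip]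
    simp only [Pi.sub_apply, sum_sub_distrib]
    rw [sum_pi_single' i]
    simp
    ring
  rw [this, abs_div, abs_mul, abs_spin]
  simp

/-! ### Local fields and the Stein equation. -/

/-- The field at `i` generated by the other spins. -/
def localField (J : Matrix (Fin n) (Fin n) ℝ) (x : Config n) (i : Fin n) : ℝ :=
  J.mulVec (spin x) i

theorem localField_flip {J : Matrix (Fin n) (Fin n) ℝ} {i : Fin n} (hd : J i i = 0)
    (x : Config n) : localField J (flip i x) i = localField J x i := by
  rw [localField, localField, spin_flip, Matrix.mulVec_sub]
  simp [hd]

theorem hamiltonian_flip {J : Matrix (Fin n) (Fin n) ℝ} (hs : J.IsSymm) {i : Fin n}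
    (hd : J i i = 0) (x : Config n) :
    hamiltonian J (flip i x) = hamiltonian J x - 2 * (spin x i * localField J x i) := by
  have h1 : spin x ⬝ᵥ J.mulVec (Pi.single i (2 * spin x i)) =
      Pi.single i (2 * spin x i) ⬝ᵥ J.mulVec (spin x) := by
    rw [Matrix.dotProduct_mulVec, ← Matrix.mulVec_transpose, hs.eq, dotProduct_comm]
  rw [hamiltonian, hamiltonian, localField, spin_flip, Matrix.mulVec_sub, sub_dotProduct,
    dotProduct_sub, dotProduct_sub, h1, single_dotProduct, single_dotProduct]
  simp [hd]
  ring

theorem hamiltonian_eq_sum (J : Matrix (Fin n) (Fin n) ℝ) (x : Config n) :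
    hamiltonian J x = (∑ i, spin x i * localField J x i) / 2 := by
  rw [hamiltonian, dotProduct]
  simp only [localField]
  ring

/-- Detailed balance: in a field `h` the two spin values have weights in ratio `exp (-2 h)`, so
their mean is `tanh h`. -/
theorem exp_tanh_balance (h : ℝ) : exp (-2 * h) * (1 + tanh h) = 1 - tanh h := by
  have e : exp (-2 * h) = exp (-h) * exp (-h) := by
    rw [← exp_add]
    ring_nf
  have e2 : exp h * exp (-h) = 1 := by rw [← exp_add]; simp
  have := exp_pos h
  have := exp_pos (-h)
  rw [tanh_eq, e]
  field_simp
  ring_nf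
  linear_combination (2 * exp (-h)) * e2

/-- The conditional mean of a spin given the others is `tanh` of the local field. -/
theorem isingExpectation_spin_sub_tanh {J : Matrix (Fin n) (Fin n) ℝ} (hs : J.IsSymm) {i : Fin n}
    (hd : J i i = 0) {ψ : Config n → ℝ} (hψ : ∀ x, ψ (flip i x) = ψ x) :
    isingExpectation J (fun x => (spin x i - tanh (localField J x i)) * ψ x) = 0 := by
  set F : Config n → ℝ := fun x => isingProb J x * ((spin x i - tanh (localField J x i)) * ψ x)
  have h1 : ∑ x, F (flip i x) = ∑ x, F x :=
    Equiv.sum_comp (Function.Involutive.toPerm (flip i) (flip_flip i)) F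
  -- The contributions of a configuration and its flip cancel in pairs.
  have h2 : ∀ x, F x + F (flip i x) = 0 := by
    intro x
    simp only [F]
    rw [hψ, localField_flip hd, spin_flip_self, isingProb, isingProb, hamiltonian_flip hs hd,
      sub_eq_add_neg (hamiltonian J x), exp_add]
    rcases spin_eq_one_or x i with h | h
    · have := exp_tanh_balance (localField J x i)
      rw [h, show -(2 * (1 * localField J x i)) = -2 * localField J x i by ring]
      linear_combination (-exp (hamiltonian J x) / partitionFunction J * ψ x) * this
    · have := exp_tanh_balance (-localField J x i)
      rw [tanh_neg] at this
      rw [h, show -(2 * (-1 * localField J x i)) = -2 * -localField J x i by ring]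
      linear_combination (exp (hamiltonian J x) / partitionFunction J * ψ x) * this
  have h3 : ∑ x, (F x + F (flip i x)) = 0 := sum_eq_zero fun x _ => h2 x
  rw [sum_add_distrib, h1] at h3
  change ∑ x, F x = 0
  linarith

/-- Mean absolute deviation of the local field at `i` from its mean-field value. -/
def fieldDeviation (J : Matrix (Fin n) (Fin n) ℝ) (β : ℝ) (i : Fin n) : ℝ :=
  isingExpectation J fun x => |localField J x i - β * magnetization x|

/-- Approximate Stein equation for a single spin. -/
theorem abs_isingExpectation_spin_sub_tanh_le {J : Matrix (Fin n) (Fin n) ℝ} (hs : J.IsSymm)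
    {i : Fin n} (hd : J i i = 0) (β : ℝ) {φ : Config n → ℝ} {L : ℝ} (hφ : ∀ x, |φ x| ≤ 1)
    (hL : ∀ x, |φ x - φ (flip i x)| ≤ L) :
    |isingExpectation J (fun x => (spin x i - tanh (β * magnetization x)) * φ x)| ≤
      fieldDeviation J β i + L := by
  -- Averaging over the spin at `i` makes the exact equation applicable. The remainder `φ - ψ` is
  -- half a flip difference, and its cofactor is at most 2, so the cost is `L`.
  set ψ : Config n → ℝ := fun x => (φ x + φ (flip i x)) / 2 with hψdef
  have hψ : ∀ x, ψ (flip i x) = ψ x := by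
    intro x
    simp only [hψdef, flip_flip]
    ring
  have h0 := isingExpectation_spin_sub_tanh hs hd hψ
  have e : isingExpectation J (fun x => (spin x i - tanh (β * magnetization x)) * φ x) =
      isingExpectation J (fun x => (tanh (localField J x i) - tanh (β * magnetization x)) * φ x +
        (spin x i - tanh (localField J x i)) * (φ x - ψ x)) := by
    rw [← sub_eq_zero, ← isingExpectation_sub, ← h0]
    congr 1
    ext x
    ring
  rw [e, fieldDeviation, ← isingExpectation_const J L, ← isingExpectation_add]
  refine abs_isingExpectation_le J fun x => (abs_add_le _ _).trans (add_le_add ?_ ?_)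
  · rw [abs_mul]
    calc _ ≤ |localField J x i - β * magnetization x| * 1 :=
          mul_le_mul (abs_tanh_sub_le _ _) (hφ x) (abs_nonneg _) (abs_nonneg _)
      _ = _ := mul_one _
  · have h1 : |spin x i - tanh (localField J x i)| ≤ 2 := by
      refine (abs_sub _ _).trans ?_
      rw [abs_spin]
      linarith [(abs_tanh_lt_one (localField J x i)).le]
    have h2 : φ x - ψ x = (φ x - φ (flip i x)) / 2 := by
      simp only [hψdef]
      ring
    rw [abs_mul, h2, abs_div, abs_two]
    have h3 := hL x
    have h4 := abs_nonneg (φ x - φ (flip i x))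
    nlinarith

/-- Approximate Stein equation for the magnetization. -/
theorem abs_isingExpectation_magnetization_sub_tanh_le {J : Matrix (Fin n) (Fin n) ℝ}
    (hs : J.IsSymm) (hd : ∀ i, J i i = 0) (hn : 0 < n) (β : ℝ) {φ : Config n → ℝ} {L : ℝ}
    (hφ : ∀ x, |φ x| ≤ 1) (hL : ∀ i x, |φ x - φ (flip i x)| ≤ L) :
    |isingExpectation J (fun x => (magnetization x - tanh (β * magnetization x)) * φ x)| ≤
      (∑ i, fieldDeviation J β i) / n + L := by
  have hn0 : (0 : ℝ) < n := by exact_mod_cast hn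
  have e : n * isingExpectation J
      (fun x => (magnetization x - tanh (β * magnetization x)) * φ x) =
      ∑ i, isingExpectation J (fun x => (spin x i - tanh (β * magnetization x)) * φ x) := by
    rw [← isingExpectation_const_mul, ← isingExpectation_sum]
    congr 1
    ext x
    rw [← sum_mul, sum_sub_distrib, ← card_mul_magnetization]
    simp
    ring
  have h : n * |isingExpectation J
      (fun x => (magnetization x - tanh (β * magnetization x)) * φ x)| ≤
      ∑ i, (fieldDeviation J β i + L) := by
    nth_rewrite 1 [← abs_of_pos hn0]
    rw [← abs_mul, e]
    exact (abs_sum_le_sum_abs _ _).trans (sum_le_sum fun i _ =>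
      abs_isingExpectation_spin_sub_tanh_le hs (hd i) β hφ (hL i))
  rw [sum_add_distrib, sum_const, card_univ, Fintype.card_fin, nsmul_eq_mul] at h
  rw [div_add' _ _ _ hn0.ne', le_div_iff₀ hn0]
  linarith

/-- A moment is compared with the corresponding power of the mean-field spin, by replacing the
spins one at a time. -/
theorem abs_isingExpectation_prod_spin_sub_le {J : Matrix (Fin n) (Fin n) ℝ} (hs : J.IsSymm)
    (hd : ∀ i, J i i = 0) {β K : ℝ} (hβ : 0 < β) (hK0 : 0 ≤ K)
    (hK : ∀ l : ℕ, l * tanh β ^ (l - 1) ≤ K) (R : Finset (Fin n)) (l : ℕ) :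
    |isingExpectation J (fun x => (∏ i ∈ R, spin x i) * tanh (β * magnetization x) ^ l) -
      isingExpectation J (fun x => tanh (β * magnetization x) ^ (l + #R))| ≤
      ∑ i ∈ R, (fieldDeviation J β i + K * β * (2 / n)) := by
  -- The exponent varies because every removed spin becomes one more factor `tanh`. The product of
  -- the remaining spins ignores the flip at `i`, so only the power of `tanh` contributes to the
  -- flip difference, and `K` bounds it for all exponents.
  induction R using Finset.induction_on generalizing l with
  | empty => simp
  | insert i R hi ih =>
    rw [sum_insert hi, card_insert_of_notMem hi, show l + (#R + 1) = (l + 1) + #R by ring]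
    refine (abs_sub_le _ (isingExpectation J
      (fun x => (∏ i ∈ R, spin x i) * tanh (β * magnetization x) ^ (l + 1))) _).trans
      (add_le_add ?_ (ih (l + 1)))
    rw [← isingExpectation_sub]
    have hT : ∀ x : Config n, |tanh (β * magnetization x)| ≤ tanh β := by
      intro x
      rw [← tanh_abs]
      refine monotone_tanh ?_
      rw [abs_mul, abs_of_pos hβ]
      nlinarith [abs_magnetization_le_one x]
    have := abs_isingExpectation_spin_sub_tanh_le hs (hd i) β
      (φ := fun x => (∏ i ∈ R, spin x i) * tanh (β * magnetization x) ^ l)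
      (L := K * β * (2 / n)) ?_ ?_
    · refine le_of_eq_of_le (congrArg _ (congrArg _ (funext fun x => ?_))) this
      rw [prod_insert hi]
      ring
    · intro x
      rw [abs_mul, abs_prod_spin, one_mul, abs_pow]
      exact pow_le_one₀ (abs_nonneg _) (abs_tanh_lt_one _).le
    · intro x
      have e : ∏ j ∈ R, spin (flip i x) j = ∏ j ∈ R, spin x j :=
        prod_congr rfl fun j hj => spin_flip_of_ne (ne_of_mem_of_not_mem hj hi) x
      rw [e, ← mul_sub, abs_mul, abs_prod_spin, one_mul]
      calc _ ≤ K * |tanh (β * magnetization x) - tanh (β * magnetization (flip i x))| :=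
            abs_pow_sub_pow_le_mul hK (hT _) (hT _) l
        _ ≤ K * |β * magnetization x - β * magnetization (flip i x)| :=
            mul_le_mul_of_nonneg_left (abs_tanh_sub_le _ _) hK0
        _ = K * β * (2 / n) := by
            rw [← mul_sub, abs_mul, abs_of_pos hβ, abs_magnetization_sub_flip]
            ring

/-- Double counting: every site lies in the same number of `k`-subsets. This turns per-site errors
into `k` times their average over the sites. -/
theorem sum_powersetCard_sum {k : ℕ} (hn : 0 < n) (a : Fin n → ℝ) :
    ∑ R ∈ powersetCard k (univ : Finset (Fin n)), ∑ i ∈ R, a i =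
      n.choose k * (k * ((∑ i, a i) / n)) := by
  have hn0 : (n : ℝ) ≠ 0 := by positivity
  cases k with
  | zero => simp
  | succ k =>
    have h1 : ∀ i : Fin n,
        #((powersetCard (k + 1) (univ : Finset (Fin n))).filter (i ∈ ·)) = (n - 1).choose k := by
      intro i
      have : (powersetCard (k + 1) (univ : Finset (Fin n))).filter (i ∈ ·) =
          (powersetCard k (univ.erase i)).image (insert i) := by
        ext R
        simp only [mem_filter, mem_powersetCard, mem_image, subset_univ, true_and]
        constructor
        · rintro ⟨hc, hi⟩
          exact ⟨R.erase i, ⟨erase_subset_erase _ (subset_univ _), by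
            rw [card_erase_of_mem hi, hc]; rfl⟩, insert_erase hi⟩
        · rintro ⟨S, ⟨hS, hc⟩, rfl⟩
          have : i ∉ S := fun h => by simpa using hS h
          exact ⟨by rw [card_insert_of_notMem this, hc], mem_insert_self _ _⟩
      rw [this, card_image_of_injOn, card_powersetCard, card_erase_of_mem (mem_univ i),
        card_univ, Fintype.card_fin]
      intro S hS S' hS' h
      have hS1 : i ∉ S := fun h => by simpa using (mem_powersetCard.1 hS).1 h
      have hS2 : i ∉ S' := fun h => by simpa using (mem_powersetCard.1 hS').1 h
      rw [← erase_insert hS1, ← erase_insert hS2]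
      exact congrArg (fun s => Finset.erase s i) h
    have h2 : ∑ R ∈ powersetCard (k + 1) (univ : Finset (Fin n)), ∑ i ∈ R, a i =
        ((n - 1).choose k : ℝ) * ∑ i, a i := by
      rw [mul_sum]
      have : ∀ R ∈ powersetCard (k + 1) (univ : Finset (Fin n)),
          ∑ i ∈ R, a i = ∑ i, if i ∈ R then a i else 0 := fun R _ => by simp
      rw [sum_congr rfl this, sum_comm]
      refine sum_congr rfl fun i _ => ?_
      rw [← sum_filter, sum_const, h1, nsmul_eq_mul]
    obtain ⟨m, rfl⟩ : ∃ m, n = m + 1 := ⟨n - 1, by omega⟩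
    have h3 : ((m + 1 : ℕ) : ℝ) * (m.choose k : ℝ) =
        ((m + 1).choose (k + 1) : ℝ) * ((k + 1 : ℕ) : ℝ) := by
      exact_mod_cast Nat.add_one_mul_choose_eq m k
    rw [h2, Nat.add_sub_cancel]
    field_simp
    linear_combination (∑ i, a i) * h3

/-! ### Nearly mean-field models: partition function and small magnetization. -/

/-- `J` is a symmetric interaction matrix without self-interaction whose local fields are, on
average over the sites, within `η` of the mean field `β * magnetization x`. -/
structure IsNearMeanField (J : Matrix (Fin n) (Fin n) ℝ) (β η : ℝ) : Prop where
  isSymm : J.IsSymm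
  diag_eq_zero : ∀ i, J i i = 0
  sum_abs_le : ∀ x : Config n, ∑ i, |localField J x i - β * magnetization x| ≤ η * n

theorem IsNearMeanField.sum_fieldDeviation_le {J : Matrix (Fin n) (Fin n) ℝ} {β η : ℝ}
    (h : IsNearMeanField J β η) : ∑ i, fieldDeviation J β i ≤ η * n := by
  simp only [fieldDeviation]
  rw [← isingExpectation_sum]
  exact (isingExpectation_mono J h.sum_abs_le).trans_eq (isingExpectation_const J _)

theorem IsNearMeanField.abs_hamiltonian_sub_le {J : Matrix (Fin n) (Fin n) ℝ} {β η : ℝ}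
    (h : IsNearMeanField J β η) (x : Config n) :
    |hamiltonian J x - n * (β * magnetization x ^ 2 / 2)| ≤ n * (η / 2) := by
  have e : hamiltonian J x - n * (β * magnetization x ^ 2 / 2) =
      (∑ i, spin x i * (localField J x i - β * magnetization x)) / 2 := by
    simp only [hamiltonian_eq_sum, mul_sub, sum_sub_distrib]
    rw [← sum_mul, ← card_mul_magnetization]
    ring
  have h1 : |∑ i, spin x i * (localField J x i - β * magnetization x)| ≤ η * n := by
    refine (abs_sum_le_sum_abs _ _).trans (le_trans (le_of_eq ?_) (h.sum_abs_le x))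
    exact sum_congr rfl fun i _ => by rw [abs_mul, abs_spin, one_mul]
  rw [e, abs_div, abs_two]
  linarith

theorem sum_exp_mul_sum_spin (n : ℕ) (a : ℝ) :
    ∑ x : Config n, exp (a * ∑ i, spin x i) = (2 * cosh a) ^ n := by
  have h : ∑ s : ℤˣ, exp (a * ((s : ℤ) : ℝ)) = 2 * cosh a := by
    rw [show (univ : Finset ℤˣ) = {1, -1} from rfl, sum_pair (by decide), cosh_eq]
    simp
    ring
  have h2 := (Fintype.prod_sum fun (_ : Fin n) (s : ℤˣ) => exp (a * ((s : ℤ) : ℝ))).symm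
  simp only [h, prod_const, card_univ, Fintype.card_fin] at h2
  rw [← h2]
  refine sum_congr rfl fun x _ => ?_
  rw [mul_sum, exp_sum]
  rfl

/-- Since `M² ≥ 2 θ M - θ²`, the Hamiltonian is bounded below by a function linear in the spins,
whose exponential sum factorizes into `(2 cosh (β θ)) ^ n`. -/
theorem IsNearMeanField.partitionFunction_ge {J : Matrix (Fin n) (Fin n) ℝ} {β η θ κ : ℝ}
    (hβ : 0 < β) (h : IsNearMeanField J β η)
    (hθ : exp (β * θ ^ 2 / 2 + κ) ≤ cosh (β * θ)) :
    2 ^ n * exp (n * (κ - η / 2)) ≤ partitionFunction J := by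
  calc 2 ^ n * exp (n * (κ - η / 2))
      = exp (-(n * (η / 2 + β * θ ^ 2 / 2))) * (2 * exp (β * θ ^ 2 / 2 + κ)) ^ n := by
        rw [mul_pow, ← exp_nat_mul, mul_left_comm, ← exp_add]
        congr 2
        ring
    _ ≤ exp (-(n * (η / 2 + β * θ ^ 2 / 2))) * (2 * cosh (β * θ)) ^ n := by gcongr
    _ = ∑ x : Config n, exp (-(n * (η / 2 + β * θ ^ 2 / 2)) + β * θ * ∑ i, spin x i) := by
        rw [← sum_exp_mul_sum_spin, mul_sum]
        simp only [exp_add]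
    _ ≤ partitionFunction J := by
        refine sum_le_sum fun x _ => exp_le_exp.2 ?_
        have h1 := (abs_le.1 (h.abs_hamiltonian_sub_le x)).1
        rw [← card_mul_magnetization]
        have h2 : 0 ≤ (n : ℝ) * (β * (magnetization x - θ) ^ 2 / 2) := by positivity
        nlinarith

/-- Configurations of small magnetization are exponentially unlikely. -/
theorem IsNearMeanField.prob_magnetization_lt_le {J : Matrix (Fin n) (Fin n) ℝ} {β η θ κ c : ℝ}
    (hβ : 0 < β) (h : IsNearMeanField J β η)
    (hθ : exp (β * θ ^ 2 / 2 + κ) ≤ cosh (β * θ)) :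
    isingExpectation J (fun x => if |magnetization x| < c then 1 else 0) ≤
      exp (-(n * (κ - η - β * c ^ 2 / 2))) := by
  have hZ := h.partitionFunction_ge hβ hθ
  have hpos : (0 : ℝ) < 2 ^ n * exp (n * (κ - η / 2)) := by positivity
  -- A uniform bound on each probability suffices: the `2 ^ n` configurations are paid for by the
  -- factor `2 ^ n` in the bound on the partition function.
  have h1 : ∀ x : Config n, isingProb J x * (if |magnetization x| < c then 1 else 0) ≤
      exp (n * (β * c ^ 2 / 2 + η / 2)) / (2 ^ n * exp (n * (κ - η / 2))) := by
    intro x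
    split_ifs with hx
    · rw [mul_one, isingProb]
      refine div_le_div₀ (exp_pos _).le (exp_le_exp.2 ?_) hpos hZ
      have h2 := (abs_le.1 (h.abs_hamiltonian_sub_le x)).2
      have h3 : magnetization x ^ 2 ≤ c ^ 2 := by
        rw [← sq_abs]
        exact pow_le_pow_left₀ (abs_nonneg _) hx.le 2
      have h4 : (n : ℝ) * (β * magnetization x ^ 2 / 2) ≤ n * (β * c ^ 2 / 2) := by gcongr
      linarith
    · rw [mul_zero]
      positivity
  refine (sum_le_sum fun x _ => h1 x).trans (le_of_eq ?_)
  rw [sum_const, card_univ, Fintype.card_fun, Fintype.card_fin,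
    show Fintype.card ℤˣ = 2 from rfl, nsmul_eq_mul, Nat.cast_pow, Nat.cast_ofNat,
    ← mul_div_assoc, mul_div_mul_left _ _ (by positivity), ← exp_sub]
  congr 1
  ring

/-! ### Concentration of `|M|` at the spontaneous magnetization. -/

/-- A Lipschitz version of the sign function. -/
def clampSign (c u : ℝ) : ℝ := max (-1) (min 1 (u / c))

theorem abs_clampSign_le (c u : ℝ) : |clampSign c u| ≤ 1 :=
  abs_le.2 ⟨le_max_left _ _, max_le (by norm_num) (min_le_left _ _)⟩

theorem abs_clampSign_sub_le {c : ℝ} (hc : 0 < c) (u v : ℝ) :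
    |clampSign c u - clampSign c v| ≤ |u - v| / c := by
  have h1 := abs_max_sub_max_le_abs (min 1 (u / c)) (min 1 (v / c)) (-1)
  have h2 := abs_min_sub_min_le_max 1 (u / c) 1 (v / c)
  rw [sub_self, abs_zero, max_eq_right (abs_nonneg _), ← sub_div, abs_div, abs_of_pos hc] at h2
  rw [clampSign, clampSign, max_comm (-1), max_comm (-1)]
  exact h1.trans h2

theorem clampSign_of_le {c u : ℝ} (hc : 0 < c) (h : c ≤ u) : clampSign c u = 1 := by
  rw [clampSign, min_eq_left ((one_le_div hc).2 h)]
  norm_num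

theorem clampSign_of_le_neg {c u : ℝ} (hc : 0 < c) (h : u ≤ -c) : clampSign c u = -1 := by
  have : u / c ≤ -1 := by
    rw [div_le_iff₀ hc]
    linarith
  rw [clampSign, min_eq_right (by linarith), max_eq_left this]

/-- The drift is odd and the clamp is the true sign outside `(-c, c)`, so the wells at `m` and `-m`
fold into one. -/
theorem clampSign_mul_drift {β c u : ℝ} (hc : 0 < c) (h : c ≤ |u|) :
    clampSign c u * (u - tanh (β * u)) = |u| - tanh (β * |u|) := by
  rcases le_abs'.1 h with h | h
  · rw [clampSign_of_le_neg hc h, abs_of_neg (by linarith), mul_neg, tanh_neg]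
    ring
  · rw [clampSign_of_le hc h, abs_of_pos (by linarith), one_mul]

theorem abs_drift_le {β u : ℝ} (hu : |u| ≤ 1) : |u - tanh (β * u)| ≤ 2 :=
  (abs_sub _ _).trans (by linarith [(abs_tanh_lt_one (β * u)).le])

/-- Even powers of the mean-field spin are determined by the drift up to a quadratic error. -/
theorem abs_pow_tanh_sub_le {β m K u : ℝ} (hβ : 0 < β) (hm0 : 0 < m) (hm1 : m < 1)
    (hm : tanh (β * m) = m) (hslope : β * (1 - m ^ 2) < 1)
    (hK : ∀ l : ℕ, l * tanh β ^ (l - 1) ≤ K) (hu : |u| ≤ 1) {k : ℕ} (hk : Even k) :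
    |tanh (β * u) ^ k - m ^ k - k * m ^ (k - 1) *
      ((1 / (1 - β * (1 - m ^ 2)) - 1) * (|u| - tanh (β * |u|)))| ≤
      k * (K * β ^ 2 + 2 * β ^ 2 / (1 - β * (1 - m ^ 2))) * (|u| - m) ^ 2 := by
  have e : tanh (β * u) ^ k = tanh (β * |u|) ^ k := by
    rcases abs_cases u with ⟨h, _⟩ | ⟨h, _⟩
    · rw [h]
    · rw [h, mul_neg, tanh_neg, hk.neg_pow]
  rw [e]
  set v := |u| with hv
  have hv0 : 0 ≤ v := abs_nonneg u
  set q := 1 - β * (1 - m ^ 2) with hq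
  have hq0 : 0 < q := by linarith
  have hb : |tanh (β * v)| ≤ tanh β := by
    rw [← tanh_abs, abs_of_nonneg (by positivity)]
    exact monotone_tanh (by nlinarith)
  have ha : |m| ≤ tanh β := by
    rw [abs_of_pos hm0, ← hm]
    exact monotone_tanh (by nlinarith)
  have hK0 : 0 ≤ K := by simpa using hK 0
  have h1 := abs_pow_taylor_le hK (tanh_lt_one β).le ha hb k
  have h2 := abs_tanh_taylor_le hm v
  have h3 : (tanh (β * v) - m) ^ 2 ≤ β ^ 2 * (v - m) ^ 2 := by
    have := abs_tanh_sub_le (β * v) (β * m)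
    rw [hm] at this
    calc _ ≤ (β * v - β * m) ^ 2 := sq_le_sq.2 this
      _ = _ := by ring
  set τ := tanh (β * v) with hτ
  -- To first order `v - τ ≈ q (v - m)` and `τ - m ≈ (1 - q) (v - m)`, so `τ - m ≈ (1 / q - 1) (v -
  -- τ)`. The linear term is thus expressed by the drift, whose expectation the Stein equation
  -- controls directly.
  have h4 : tanh (β * v) ^ k - m ^ k - k * m ^ (k - 1) * ((1 / q - 1) * (v - τ)) =
      (τ ^ k - m ^ k - k * m ^ (k - 1) * (τ - m)) +
        k * m ^ (k - 1) * ((τ - m - β * (1 - m ^ 2) * (v - m)) / q) := by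
    have : β * (1 - m ^ 2) = 1 - q := by rw [hq]; ring
    rw [this]
    field_simp
    ring
  rw [h4]
  refine (abs_add_le _ _).trans ?_
  have h5 : |(k : ℝ) * m ^ (k - 1) * ((τ - m - β * (1 - m ^ 2) * (v - m)) / q)| ≤
      k * 1 * (2 * β ^ 2 * (v - m) ^ 2 / q) := by
    rw [abs_mul, abs_mul, abs_div, abs_of_pos hq0, Nat.abs_cast, abs_of_nonneg (by positivity)]
    gcongr
    exact pow_le_one₀ hm0.le hm1.le
  have h6 : (k : ℝ) * K * (τ - m) ^ 2 ≤ k * K * (β ^ 2 * (v - m) ^ 2) := by gcongr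
  calc _ ≤ k * K * (β ^ 2 * (v - m) ^ 2) + k * 1 * (2 * β ^ 2 * (v - m) ^ 2 / q) :=
        add_le_add (h1.trans h6) h5
    _ = _ := by ring

/-- Even moments of the mean-field spin under a nearly mean-field Ising model. -/
theorem exists_abs_isingExpectation_tanh_pow_sub_le {β : ℝ} (hβ : 1 < β) :
    ∃ m η₀ C : ℝ, 0 < m ∧ m < 1 ∧ 0 < η₀ ∧ 0 ≤ C ∧
      ∀ (n : ℕ) (J : Matrix (Fin n) (Fin n) ℝ) (η : ℝ), 0 < n → 0 ≤ η → η ≤ η₀ →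
        IsNearMeanField J β η → ∀ k : ℕ, Even k →
          |isingExpectation J (fun x => tanh (β * magnetization x) ^ k) - m ^ k| ≤
            k * C * (η + 1 / n) := by
  have hβ0 : 0 < β := by linarith
  obtain ⟨θ, κ, hκ, hθ⟩ := exists_tilt hβ
  -- This bound on `c` gives `β c² / 2 ≤ κ / 4`. Together with `η ≤ κ / 4` it leaves the decay rate
  -- `κ / 2` for the event `|M| < c`.
  obtain ⟨c, m, r, hc, hcb, hcm, hm1, hm, hslope, hr, hdrift⟩ :=
    exists_magnetization (b := min 1 (κ / (2 * β))) hβ (by positivity)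
  obtain ⟨K, hK0, hK⟩ := exists_mul_pow_pred_bound (tanh_nonneg hβ0.le) (tanh_lt_one β)
  have hm0 : 0 < m := hc.trans hcm
  have hcκ : β * c ^ 2 / 2 ≤ κ / 4 := by
    have h1 : c ≤ 1 := hcb.trans (min_le_left _ _)
    have h2 : c ≤ κ / (2 * β) := hcb.trans (min_le_right _ _)
    rw [le_div_iff₀ (by positivity)] at h2
    nlinarith [mul_pos hβ0 hc]
  set q := 1 - β * (1 - m ^ 2) with hq
  have hq0 : 0 < q := by linarith
  -- A flip moves `M` by `2 / n`; the test functions have Lipschitz constant at most `1 / c + 1` in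
  -- `M`, from the clamp and from `|M| - m`. The terms with `2 / κ` below pay for the event `|M| <
  -- c`.
  set A := 1 + (1 / c + 1) * 2 with hA
  set C₁ := A + 4 * (2 / κ) with hC₁
  set C₂ := (A + (r + 2) * (2 / κ)) / r with hC₂
  set B := K * β ^ 2 + 2 * β ^ 2 / q with hB
  have hB0 : 0 ≤ B := by positivity
  refine ⟨m, κ / 4, |1 / q - 1| * C₁ + B * C₂, hm0, hm1, by positivity, by positivity, ?_⟩
  intro n J η hn hη0 hη hJ k hk
  have hn0 : (0 : ℝ) < n := by exact_mod_cast hn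
  set δ := η + 1 / (n : ℝ) with hδ
  set bad : Config n → ℝ := fun x => if |magnetization x| < c then 1 else 0 with hbad
  set D : Config n → ℝ := fun x => |magnetization x| - tanh (β * |magnetization x|) with hD
  set V : Config n → ℝ := fun x => |magnetization x| - m with hV
  have hP : isingExpectation J bad ≤ 2 / κ * δ := by
    have h1 := hJ.prob_magnetization_lt_le (c := c) hβ0 hθ
    have h2 : (0 : ℝ) < n * (κ / 2) := by positivity
    calc _ ≤ _ := h1
      _ ≤ exp (-(n * (κ / 2))) := by
          refine exp_le_exp.2 (neg_le_neg (mul_le_mul_of_nonneg_left ?_ hn0.le))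
          linarith
      _ ≤ 1 / (n * (κ / 2)) := by
          rw [exp_neg, ← one_div]
          exact one_div_le_one_div_of_le h2 (by linarith [add_one_le_exp (n * (κ / 2))])
      _ = 2 / κ * (1 / n) := by field_simp
      _ ≤ _ := by
          gcongr
          linarith
  have hdev : (∑ i, fieldDeviation J β i) / n ≤ η := by
    rw [div_le_iff₀ hn0]
    exact hJ.sum_fieldDeviation_le
  have hstein : ∀ φ : Config n → ℝ, (∀ x, |φ x| ≤ 1) →
      (∀ i x, |φ x - φ (flip i x)| ≤ (1 / c + 1) * (2 / n)) →
      |isingExpectation J (fun x => (magnetization x - tanh (β * magnetization x)) * φ x)| ≤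
        A * δ := by
    intro φ hφ hL
    refine (abs_isingExpectation_magnetization_sub_tanh_le hJ.isSymm hJ.diag_eq_zero hn β hφ
      hL).trans ?_
    have : 0 ≤ (1 / c + 1) * 2 * η := by positivity
    calc _ ≤ η + (1 / c + 1) * (2 / n) := by linarith
      _ ≤ A * δ := by
        have h1 : (0 : ℝ) ≤ 1 / n := by positivity
        rw [hA, hδ]
        have h2 : (1 / c + 1) * (2 / n) = (1 / c + 1) * 2 * (1 / (n : ℝ)) := by ring
        rw [h2]
        linarith
  have hVle : ∀ x, |V x| ≤ 1 := fun x => by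
    have h1 := abs_magnetization_le_one x
    have h2 := abs_nonneg (magnetization x)
    rw [abs_le]
    constructor <;> simp only [hV] <;> linarith
  have hsflip : ∀ (i : Fin n) (x : Config n),
      |clampSign c (magnetization x) - clampSign c (magnetization (flip i x))| ≤
        1 / c * (2 / n) := fun i x => by
    refine (abs_clampSign_sub_le hc _ _).trans_eq ?_
    rw [abs_magnetization_sub_flip]
    ring
  -- Test function: the clamped sign.
  have hED : |isingExpectation J D| ≤ C₁ * δ := by
    have h1 := hstein (fun x => clampSign c (magnetization x)) (fun x => abs_clampSign_le _ _)
      (fun i x => (hsflip i x).trans (by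
        have : (0 : ℝ) ≤ 2 / n := by positivity
        linarith))
    have h2 := abs_isingExpectation_le J (f := fun x => D x -
      (magnetization x - tanh (β * magnetization x)) * clampSign c (magnetization x))
      (g := fun x => 4 * bad x) (fun x => by
        simp only [hbad, hD]
        split_ifs with hx
        · refine (abs_sub _ _).trans ?_
          rw [abs_mul]
          have h3 := abs_drift_le (β := β) (abs_magnetization_le_one x)
          have h4 := abs_drift_le (β := β) (u := |magnetization x|)
            (by rw [abs_abs]; exact abs_magnetization_le_one x)
          have h5 := abs_clampSign_le c (magnetization x)
          have := mul_le_mul h3 h5 (abs_nonneg _) zero_le_two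
          linarith
        · rw [mul_comm (magnetization x - _), clampSign_mul_drift hc (not_lt.1 hx)]
          simp)
    rw [isingExpectation_sub, isingExpectation_const_mul] at h2
    have h3 := abs_sub_abs_le_abs_sub (isingExpectation J D) (isingExpectation J fun x =>
      (magnetization x - tanh (β * magnetization x)) * clampSign c (magnetization x))
    rw [hC₁]
    linarith
  -- Test function: the clamped sign times `|M| - m`. Where `|M| ≥ c`, the integrand dominates `r
  -- (|M| - m)²`.
  have hEV : isingExpectation J (fun x => V x ^ 2) ≤ C₂ * δ := by
    have h1 := hstein (fun x => clampSign c (magnetization x) * V x)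
      (fun x => by
        rw [abs_mul]
        exact mul_le_one₀ (abs_clampSign_le _ _) (abs_nonneg _) (hVle x))
      (fun i x => by
        have e : clampSign c (magnetization x) * V x -
            clampSign c (magnetization (flip i x)) * V (flip i x) =
            (clampSign c (magnetization x) - clampSign c (magnetization (flip i x))) * V x +
              clampSign c (magnetization (flip i x)) *
                (|magnetization x| - |magnetization (flip i x)|) := by
          simp only [hV]
          ring
        rw [e, add_mul]
        refine (abs_add_le _ _).trans (add_le_add ?_ ?_)
        · rw [abs_mul]
          exact (mul_le_mul (hsflip i x) (hVle x) (abs_nonneg _) (by positivity)).trans_eq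
            (mul_one _)
        · rw [abs_mul]
          refine mul_le_mul (abs_clampSign_le _ _) ?_ (abs_nonneg _) zero_le_one
          rw [← abs_magnetization_sub_flip i x]
          exact abs_abs_sub_abs_le _ _)
    have h2 := isingExpectation_mono J (f := fun x => r * V x ^ 2)
      (g := fun x => (magnetization x - tanh (β * magnetization x)) *
        (clampSign c (magnetization x) * V x) + (r + 2) * bad x) (fun x => by
        simp only [hbad]
        split_ifs with hx
        · have h3 := abs_drift_le (β := β) (abs_magnetization_le_one x)
          have h5 : |clampSign c (magnetization x) * V x| ≤ 1 := by
            rw [abs_mul]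
            exact mul_le_one₀ (abs_clampSign_le _ _) (abs_nonneg _) (hVle x)
          have h6 := mul_le_mul h3 h5 (abs_nonneg _) zero_le_two
          rw [← abs_mul] at h6
          have h7 := (abs_le.1 h6).1
          have h8 : V x ^ 2 ≤ 1 := by
            rw [← sq_abs]
            exact pow_le_one₀ (abs_nonneg _) (hVle x)
          nlinarith
        · have := hdrift _ (not_lt.1 hx)
          rw [← mul_assoc, mul_comm (magnetization x - _), clampSign_mul_drift hc (not_lt.1 hx)]
          simpa using this)
    rw [isingExpectation_const_mul, isingExpectation_add, isingExpectation_const_mul] at h2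
    have h3 := le_abs_self (isingExpectation J fun x =>
      (magnetization x - tanh (β * magnetization x)) * (clampSign c (magnetization x) * V x))
    rw [hC₂, div_mul_eq_mul_div, le_div_iff₀ hr]
    have h4 := mul_le_mul_of_nonneg_left hP (show 0 ≤ r + 2 by linarith)
    linarith
  have hmain := abs_isingExpectation_le J (f := fun x =>
    tanh (β * magnetization x) ^ k - m ^ k - k * m ^ (k - 1) * ((1 / q - 1) * D x))
    (g := fun x => k * B * V x ^ 2)
    (fun x => abs_pow_tanh_sub_le hβ0 hm0 hm1 hm hslope hK (abs_magnetization_le_one x) hk)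
  rw [isingExpectation_sub, isingExpectation_sub, isingExpectation_const,
    isingExpectation_const_mul, isingExpectation_const_mul, isingExpectation_const_mul] at hmain
  have h1 := abs_sub_abs_le_abs_sub
    (isingExpectation J (fun x => tanh (β * magnetization x) ^ k) - m ^ k)
    (k * m ^ (k - 1) * ((1 / q - 1) * isingExpectation J D))
  have h2 : |(k : ℝ) * m ^ (k - 1) * ((1 / q - 1) * isingExpectation J D)| ≤
      k * 1 * (|1 / q - 1| * (C₁ * δ)) := by
    rw [abs_mul, abs_mul, abs_mul, Nat.abs_cast, abs_of_nonneg (a := m ^ (k - 1)) (by positivity)]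
    gcongr
    exact pow_le_one₀ hm0.le hm1.le
  have h3 : (k : ℝ) * B * isingExpectation J (fun x => V x ^ 2) ≤ k * B * (C₂ * δ) := by gcongr
  calc _ ≤ k * 1 * (|1 / q - 1| * (C₁ * δ)) + k * B * (C₂ * δ) := by linarith
    _ = _ := by ring

/-! ### From powers of the mean-field spin to averaged moments. -/

/-- Mean absolute deviation of the moments from the powers of the spontaneous magnetization. -/
theorem exists_sum_abs_moment_sub_le {β : ℝ} (hβ : 1 < β) :
    ∃ m C : ℝ, 0 ≤ C ∧
      ∀ (n : ℕ) (J : Matrix (Fin n) (Fin n) ℝ) (η : ℝ), 0 < n → 0 ≤ η → IsNearMeanField J β η →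
        ∀ k : ℕ, 0 < k → Even k →
          ∑ R ∈ powersetCard k (univ : Finset (Fin n)), |moment J R - m ^ k| ≤
            n.choose k * (k * C * (η + 1 / n)) := by
  have hβ0 : 0 < β := by linarith
  obtain ⟨m, η₀, C, hm0, hm1, hη₀, hC, hmain⟩ := exists_abs_isingExpectation_tanh_pow_sub_le hβ
  obtain ⟨K, hK0, hK⟩ := exists_mul_pow_pred_bound (tanh_nonneg hβ0.le) (tanh_lt_one β)
  -- The summand `2 / η₀` covers `η > η₀`, where the trivial bound 2 on the difference is enough.
  refine ⟨m, C + 1 + 2 * K * β + 2 / η₀, by positivity, ?_⟩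
  intro n J η hn hη hJ k hk hke
  have hn0 : (0 : ℝ) < n := by exact_mod_cast hn
  have hk1 : (1 : ℝ) ≤ k := by exact_mod_cast hk
  have hcard : #(powersetCard k (univ : Finset (Fin n))) = n.choose k := by
    rw [card_powersetCard, card_univ, Fintype.card_fin]
  set δ := η + 1 / (n : ℝ) with hδ
  have hηδ : η ≤ δ := by
    have : (0 : ℝ) ≤ 1 / n := by positivity
    linarith
  have hnδ : 1 / (n : ℝ) ≤ δ := by linarith
  have hδ0 : 0 ≤ δ := hη.trans hηδ
  rcases le_or_gt η η₀ with h | h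
  · have hR : ∀ R ∈ powersetCard k (univ : Finset (Fin n)), |moment J R - m ^ k| ≤
        ∑ i ∈ R, (fieldDeviation J β i + K * β * (2 / n)) + k * C * δ := by
      intro R hR
      have h1 := abs_isingExpectation_prod_spin_sub_le hJ.isSymm hJ.diag_eq_zero hβ0 hK0 hK R 0
      simp only [pow_zero, mul_one, zero_add, (mem_powersetCard.1 hR).2] at h1
      exact (abs_sub_le _ _ _).trans (add_le_add h1 (hmain n J η hn hη h hJ k hke))
    refine (sum_le_sum hR).trans ?_
    rw [sum_add_distrib, sum_powersetCard_sum hn, sum_const, hcard, nsmul_eq_mul, ← mul_add]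
    refine mul_le_mul_of_nonneg_left ?_ (Nat.cast_nonneg _)
    have h2 : (∑ i, (fieldDeviation J β i + K * β * (2 / n))) / n ≤ (1 + 2 * K * β) * δ := by
      have h3 : 2 * K * β * (1 / n) ≤ 2 * K * β * δ := by gcongr
      rw [div_le_iff₀ hn0, sum_add_distrib, sum_const, card_univ, Fintype.card_fin, nsmul_eq_mul]
      calc _ ≤ η * n + n * (K * β * (2 / n)) := by linarith [hJ.sum_fieldDeviation_le]
        _ = (η + 2 * K * β * (1 / n)) * n := by ring
        _ ≤ _ := by
          gcongr
          linarith
    calc (k : ℝ) * ((∑ i, (fieldDeviation J β i + K * β * (2 / n))) / n) + k * C * δ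
        ≤ k * ((1 + 2 * K * β) * δ) + k * C * δ := by gcongr
      _ = k * (C + 1 + 2 * K * β) * δ := by ring
      _ ≤ _ := by
        refine mul_le_mul_of_nonneg_right (mul_le_mul_of_nonneg_left ?_ (by positivity)) hδ0
        linarith [show 0 ≤ 2 / η₀ by positivity]
  · have hR : ∀ R ∈ powersetCard k (univ : Finset (Fin n)), |moment J R - m ^ k| ≤ 2 := by
      intro R _
      refine (abs_sub _ _).trans ?_
      have h1 := abs_moment_le_one J R
      have h2 : |m ^ k| ≤ 1 := by
        rw [abs_of_pos (by positivity)]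
        exact pow_le_one₀ hm0.le hm1.le
      linarith
    refine (sum_le_sum hR).trans ?_
    rw [sum_const, hcard, nsmul_eq_mul]
    refine mul_le_mul_of_nonneg_left ?_ (Nat.cast_nonneg _)
    calc (2 : ℝ) = 1 * (2 / η₀) * η₀ := by field_simp
      _ ≤ k * (C + 1 + 2 * K * β + 2 / η₀) * δ := by
        gcongr
        · have : 0 ≤ C + 1 + 2 * K * β := by positivity
          linarith
        · exact h.le.trans hηδ

/-- The number `m` depends on `β` alone, so the triangle inequality through `m ^ k` compares the two
models. -/
theorem exists_avgMomentError_le {β : ℝ} (hβ : 1 < β) :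
    ∃ C : ℝ, 0 ≤ C ∧
      ∀ (n : ℕ) (J J' : Matrix (Fin n) (Fin n) ℝ) (η η' : ℝ), 0 < n → 0 ≤ η → 0 ≤ η' →
        IsNearMeanField J β η → IsNearMeanField J' β η' → ∀ k : ℕ, 0 < k → Even k →
          avgMomentError J J' k ≤ k * C * (η + η' + 2 / n) := by
  obtain ⟨m, C, hC, h⟩ := exists_sum_abs_moment_sub_le hβ
  refine ⟨C, hC, fun n J J' η η' hn hη hη' hJ hJ' k hk hke => ?_⟩
  have h1 := h n J η hn hη hJ k hk hke
  have h2 := h n J' η' hn hη' hJ' k hk hke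
  have h3 : ∑ R ∈ powersetCard k (univ : Finset (Fin n)), |moment J R - moment J' R| ≤
      n.choose k * (k * C * (η + η' + 2 / n)) := by
    calc _ ≤ ∑ R ∈ powersetCard k (univ : Finset (Fin n)),
          (|moment J R - m ^ k| + |moment J' R - m ^ k|) := by
          refine sum_le_sum fun R _ => ?_
          rw [abs_sub_comm (moment J' R)]
          exact abs_sub_le _ _ _
      _ ≤ _ := by
          rw [sum_add_distrib]
          refine (add_le_add h1 h2).trans_eq ?_
          ring
  rw [avgMomentError, one_div, ← div_eq_inv_mul]
  exact div_le_of_le_mul₀ (by positivity) (by positivity) (by rwa [mul_comm] at h3)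

/-! ### The two models are nearly mean-field. -/

theorem isNearMeanField_curieWeissMatrix {β : ℝ} (hβ : 0 < β) (hn : 0 < n) :
    IsNearMeanField (curieWeissMatrix n β) β (β / n) where
  isSymm := by
    rw [curieWeissMatrix]
    exact (SimpleGraph.isSymm_adjMatrix _).smul _
  diag_eq_zero i := by simp [curieWeissMatrix]
  sum_abs_le x := by
    have hn0 : (0 : ℝ) < n := by exact_mod_cast hn
    have h : ∀ i, |localField (curieWeissMatrix n β) x i - β * magnetization x| = β / n := by
      intro i
      have h1 : ((⊤ : SimpleGraph (Fin n)).adjMatrix ℝ).mulVec (spin x) i =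
          ∑ j, spin x j - spin x i := by
        rw [SimpleGraph.adjMatrix_mulVec_apply, ← add_sum_erase univ _ (mem_univ i)]
        have : (⊤ : SimpleGraph (Fin n)).neighborFinset i = univ.erase i := by
          ext j
          simp [eq_comm]
        rw [this]
        ring
      have h2 : localField (curieWeissMatrix n β) x i - β * magnetization x =
          -(β / n * spin x i) := by
        rw [localField, curieWeissMatrix, Matrix.smul_mulVec, Pi.smul_apply, h1, smul_eq_mul,
          magnetization]
        ring
      rw [h2, abs_neg, abs_mul, abs_spin, abs_of_pos (by positivity), mul_one]
    simp [h]
    exact le_of_eq (mul_comm _ _)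

/-- A symmetric matrix with all eigenvalues in `[-r, r]` has operator norm at most `r`. -/
theorem sum_mulVec_sq_le {A : Matrix (Fin n) (Fin n) ℝ} (hA : A.IsHermitian) {r : ℝ}
    (hr : ∀ (v : Fin n → ℝ) (lam : ℝ), v ≠ 0 → A.mulVec v = lam • v → |lam| ≤ r)
    (x : Fin n → ℝ) : ∑ i, A.mulVec x i ^ 2 ≤ r ^ 2 * ∑ i, x i ^ 2 := by
  set b := hA.eigenvectorBasis with hb
  have hsq : ∀ y : Fin n → ℝ, ∑ i, (((b i : EuclideanSpace ℝ (Fin n)) : Fin n → ℝ) ⬝ᵥ y) ^ 2 =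
      ∑ i, y i ^ 2 := by
    intro y
    have h := b.sum_sq_norm_inner_right (WithLp.toLp 2 y)
    rw [EuclideanSpace.norm_sq_eq] at h
    simp only [norm_eq_abs, sq_abs] at h
    rw [← h]
    refine sum_congr rfl fun i _ => ?_
    rw [EuclideanSpace.inner_eq_star_dotProduct, dotProduct_comm]
    simp
  have hev : ∀ i, ((b i : EuclideanSpace ℝ (Fin n)) : Fin n → ℝ) ⬝ᵥ A.mulVec x =
      hA.eigenvalues i * (((b i : EuclideanSpace ℝ (Fin n)) : Fin n → ℝ) ⬝ᵥ x) := by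
    intro i
    have hT : A.transpose = A := by simpa using hA.eq
    rw [Matrix.dotProduct_mulVec, ← Matrix.mulVec_transpose, hT, hb, hA.mulVec_eigenvectorBasis,
      smul_dotProduct, smul_eq_mul]
  rw [← hsq (A.mulVec x), ← hsq x, mul_sum]
  refine sum_le_sum fun i _ => ?_
  rw [hev, mul_pow]
  refine mul_le_mul_of_nonneg_right ?_ (sq_nonneg _)
  have h0 : ((b i : EuclideanSpace ℝ (Fin n)) : Fin n → ℝ) ≠ 0 := by
    intro h
    refine b.orthonormal.ne_zero i ?_
    ext j
    exact congrFun h j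
  have := hr _ _ h0 (hA.mulVec_eigenvectorBasis i)
  rw [← sq_abs]
  exact pow_le_pow_left₀ (abs_nonneg _) this 2

/-- Subtracting `d / n` from every entry of the adjacency matrix leaves a matrix `E` of operator
norm at most `r`, and the field deviations are `β / d` times the entries of `E` applied to the
spins. Cauchy-Schwarz bounds their absolute sum, as the spin vector has norm `√n`. -/
theorem isNearMeanField_graphMatrix {G : SimpleGraph (Fin n)} [DecidableRel G.Adj] {d : ℕ}
    {r β : ℝ} (hβ : 0 < β) (hr : 0 ≤ r) (hG : IsRegularWithSpectralBound G d r) :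
    IsNearMeanField (graphMatrix G d β) β (β * r / d) where
  isSymm := by
    rw [graphMatrix]
    exact (SimpleGraph.isSymm_adjMatrix _).smul _
  diag_eq_zero i := by simp [graphMatrix]
  sum_abs_le x := by
    obtain ⟨hd, hreg, hspec⟩ := hG
    have hd0 : (0 : ℝ) < d := by exact_mod_cast hd
    rcases Nat.eq_zero_or_pos n with rfl | hn
    · simp
    have hn0 : (0 : ℝ) < n := by exact_mod_cast hn
    set E : Matrix (Fin n) (Fin n) ℝ := G.adjMatrix ℝ - (d / n : ℝ) • Matrix.of fun _ _ => 1
      with hE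
    have hEv : ∀ v : Fin n → ℝ, E.mulVec v =
        (G.adjMatrix ℝ).mulVec v - fun _ => d / n * ∑ i, v i := by
      intro v
      ext i
      rw [hE, Matrix.sub_mulVec, Matrix.smul_mulVec]
      simp [Matrix.mulVec, dotProduct]
    have hEH : E.IsHermitian := by
      ext i j
      simp [hE, SimpleGraph.adjMatrix_apply, SimpleGraph.adj_comm]
    have hE1 : ∀ v : Fin n → ℝ, E.mulVec v ⬝ᵥ 1 = 0 := by
      intro v
      have h1 : (G.adjMatrix ℝ).mulVec v ⬝ᵥ 1 = d * ∑ i, v i := by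
        rw [dotProduct_comm, Matrix.dotProduct_mulVec, ← Matrix.mulVec_transpose,
          SimpleGraph.transpose_adjMatrix]
        have : (G.adjMatrix ℝ).mulVec 1 = fun _ => (d : ℝ) := by
          ext i
          simp [SimpleGraph.adjMatrix_mulVec_apply, hreg i]
        rw [this, dotProduct, mul_sum]
      rw [hEv, sub_dotProduct, h1]
      simp [dotProduct]
      field_simp
      ring
    -- The range of `E` is orthogonal to the all-ones vector, hence so is every eigenvector with
    -- nonzero eigenvalue, and on such vectors `E` agrees with the adjacency matrix.
    have hEr : ∀ (v : Fin n → ℝ) (lam : ℝ), v ≠ 0 → E.mulVec v = lam • v → |lam| ≤ r := by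
      intro v lam hv h
      rcases eq_or_ne lam 0 with rfl | hl
      · simpa using hr
      have h1 : v ⬝ᵥ 1 = 0 := by
        have := hE1 v
        rw [h, smul_dotProduct, smul_eq_mul] at this
        exact (mul_eq_zero.1 this).resolve_left hl
      refine hspec v lam hv h1 ?_
      have h2 : ∑ i, v i = 0 := by simpa [dotProduct] using h1
      rw [← h, hEv, h2]
      ext i
      simp
    have hle := sum_mulVec_sq_le hEH hEr (spin x)
    simp only [spin_sq, sum_const, card_univ, Fintype.card_fin, nsmul_eq_mul, mul_one] at hle
    have hf : ∀ i, |localField (graphMatrix G d β) x i - β * magnetization x| =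
        β / d * |E.mulVec (spin x) i| := by
      intro i
      have : localField (graphMatrix G d β) x i - β * magnetization x =
          β / d * E.mulVec (spin x) i := by
        rw [localField, graphMatrix, Matrix.smul_mulVec, Pi.smul_apply, hEv, Pi.sub_apply,
          smul_eq_mul, magnetization]
        field_simp
      rw [this, abs_mul, abs_of_pos (by positivity)]
    have hcs : ∑ i, |E.mulVec (spin x) i| ≤ r * n := by
      refine abs_le_of_sq_le_sq' ?_ (by positivity) |>.2
      have h1 := sq_sum_le_card_mul_sum_sq (s := univ) (f := fun i => |E.mulVec (spin x) i|)
      simp only [sq_abs, card_univ, Fintype.card_fin] at h1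
      calc _ ≤ _ := h1
        _ ≤ n * (r ^ 2 * n) := by gcongr
        _ = _ := by ring
    simp only [hf]
    rw [← mul_sum]
    calc _ ≤ β / d * (r * n) := by gcongr
      _ = _ := by ring

theorem avgPairError_le_avgMomentError (J K : Matrix (Fin n) (Fin n) ℝ) :
    avgPairError J K ≤ avgMomentError J K 2 := by
  rw [avgPairError, avgMomentError]
  refine mul_le_mul_of_nonneg_left ?_ (by positivity)
  have hpair : ∀ (L : Matrix (Fin n) (Fin n) ℝ) {i j : Fin n}, i < j →
      pairCorrelation L i j = moment L {i, j} := by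
    intro L i j h
    simp only [pairCorrelation, moment, prod_pair h.ne]
  rw [sum_sigma']
  calc _ = ∑ p ∈ univ.sigma fun j : Fin n => univ.filter fun i : Fin n => i < j,
        |moment J {p.2, p.1} - moment K {p.2, p.1}| := by
        refine sum_congr rfl fun p hp => ?_
        have hlt : p.2 < p.1 := by simpa using hp
        rw [hpair J hlt, hpair K hlt]
    _ = ∑ R ∈ (univ.sigma fun j : Fin n => univ.filter fun i : Fin n => i < j).image
          (fun p => ({p.2, p.1} : Finset (Fin n))), |moment J R - moment K R| := by
        rw [sum_image]
        rintro ⟨j, i⟩ hp ⟨j', i'⟩ hp' h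
        have h1 : i < j := by simpa using hp
        have h2 : i' < j' := by simpa using hp'
        have h3 : i ∈ ({i', j'} : Finset (Fin n)) := by
          rw [← show ({i, j} : Finset (Fin n)) = {i', j'} from h]
          simp
        have h4 : j ∈ ({i', j'} : Finset (Fin n)) := by
          rw [← show ({i, j} : Finset (Fin n)) = {i', j'} from h]
          simp
        simp only [mem_insert, mem_singleton] at h3 h4
        have : i = i' ∧ j = j' := by
          constructor <;> omega
        obtain ⟨rfl, rfl⟩ := this
        rfl
    _ ≤ _ := by
        refine sum_le_sum_of_subset_of_nonneg ?_ fun _ _ _ => abs_nonneg _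
        intro R hR
        obtain ⟨p, hp, rfl⟩ := mem_image.1 hR
        have hlt : p.2 < p.1 := by simpa using hp
        exact mem_powersetCard.2 ⟨subset_univ _, card_pair hlt.ne⟩

end IsingMoments

end

/-! ### Assembly of the constants. -/

theorem theorem4p3 (β : ℝ) (hβ : 1 < β) :
    ∃ ε₀ C : ℝ, 0 < ε₀ ∧ 0 < C ∧
      (∀ (n d : ℕ) (G : SimpleGraph (Fin n)) [DecidableRel G.Adj] (ε : ℝ),
        IsingMoments.IsExpander G d ε → ε < ε₀ →
          (∀ k : ℕ, 0 < k → Even k → k < n →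
            IsingMoments.avgMomentError (IsingMoments.curieWeissMatrix n β)
              (IsingMoments.graphMatrix G d β) k ≤ k * C * (ε + 1 / n)) ∧
          IsingMoments.avgPairError (IsingMoments.curieWeissMatrix n β)
            (IsingMoments.graphMatrix G d β) < 2 * C * (ε + 1 / n)) ∧
      (∀ (n d : ℕ) (G : SimpleGraph (Fin n)) [DecidableRel G.Adj] (δ : ℝ), 0 ≤ δ →
        IsingMoments.IsApproxRamanujan G d δ →
          ∀ k : ℕ, 0 < k → Even k → k < n →
            IsingMoments.avgMomentError (IsingMoments.curieWeissMatrix n β)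
              (IsingMoments.graphMatrix G d β) k ≤ k * C * (1 + δ) / Real.sqrt d) := by
  open IsingMoments in
  have hβ0 : 0 < β := by linarith
  obtain ⟨C, hC, h⟩ := exists_avgMomentError_le hβ
  -- Large `η` is already absorbed in `C`, so `ε₀ = 1` will do. The factor `3 β + 2` is what the
  -- Ramanujan case needs: `β + 2` for the `1 / n` terms and `2 β` for the spectral term. The final
  -- 1 makes the pair bound strict.
  refine ⟨1, C * (3 * β + 2) + 1, one_pos, by positivity, ?_, ?_⟩
  · intro n d G _ ε hG _
    obtain ⟨hε, -, hspec⟩ := hG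
    have hd0 : (0 : ℝ) < d := by exact_mod_cast hspec.1
    have hnear := isNearMeanField_graphMatrix hβ0 (by positivity) hspec
    rw [show β * (ε * d) / d = β * ε by field_simp] at hnear
    have key : 0 < n → ∀ k : ℕ, 0 < k → Even k →
        avgMomentError (curieWeissMatrix n β) (graphMatrix G d β) k <
          k * (C * (3 * β + 2) + 1) * (ε + 1 / n) := by
      intro hn k hk hke
      have hk0 : (0 : ℝ) < k := by exact_mod_cast hk
      have hn0 : (0 : ℝ) < n := by exact_mod_cast hn
      have h1 := h n _ _ _ _ hn (by positivity) (by positivity)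
        (isNearMeanField_curieWeissMatrix hβ0 hn) hnear k hk hke
      have hu : (0 : ℝ) < 1 / n := by positivity
      have h2 : β / n + β * ε + 2 / n ≤ (3 * β + 2) * (ε + 1 / n) := by
        rw [show β / n = β * (1 / (n : ℝ)) by ring, show 2 / (n : ℝ) = 2 * (1 / n) by ring]
        nlinarith [mul_pos hβ0 hε, mul_pos hβ0 hu]
      calc _ ≤ _ := h1
        _ ≤ k * C * ((3 * β + 2) * (ε + 1 / n)) := by gcongr
        _ < k * C * ((3 * β + 2) * (ε + 1 / n)) + k * (ε + 1 / n) :=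
          lt_add_of_pos_right _ (by positivity)
        _ = _ := by ring
    refine ⟨fun k hk hke hkn => (key (hk.trans hkn) k hk hke).le, ?_⟩
    refine (avgPairError_le_avgMomentError _ _).trans_lt ?_
    -- For `n = 0` the error is `0` and `1 / n = 0`, while `ε > 0` keeps the bound positive.
    rcases Nat.eq_zero_or_pos n with rfl | hn
    · simp [avgMomentError]
      positivity
    · exact_mod_cast key hn 2 two_pos even_two
  · intro n d G _ δ hδ hG k hk hke hkn
    have hn : 0 < n := hk.trans hkn
    have hn0 : (0 : ℝ) < n := by exact_mod_cast hn
    have hd1 : (1 : ℝ) ≤ d := by exact_mod_cast hG.1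
    have hd0 : (0 : ℝ) < d := by linarith
    -- A simple graph has degrees below `n`; this lets `1 / √d` absorb `1 / n`.
    have hdn : (d : ℝ) ≤ n := by
      have h1 := G.degree_lt_card_verts ⟨0, hn⟩
      rw [hG.2.1 ⟨0, hn⟩, Fintype.card_fin] at h1
      exact_mod_cast h1.le
    have hnear := isNearMeanField_graphMatrix hβ0 (by positivity) hG
    have h1 := h n _ _ _ _ hn (by positivity) (by positivity)
      (isNearMeanField_curieWeissMatrix hβ0 hn) hnear k hk hke
    have hs0 : 0 < √(d : ℝ) := Real.sqrt_pos.2 hd0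
    have hs1 : 1 ≤ √(d : ℝ) := Real.one_le_sqrt.2 hd1
    have hsd : √(d : ℝ) * √(d : ℝ) = d := Real.mul_self_sqrt hd0.le
    have hle : √((d : ℝ) - 1) ≤ √(d : ℝ) := Real.sqrt_le_sqrt (by linarith)
    set w := (1 + δ) / √(d : ℝ) with hw
    have hnw : 1 / (n : ℝ) ≤ w := by
      rw [hw, div_le_div_iff₀ hn0 hs0]
      nlinarith
    have hrw : (√((d : ℝ) - 1) + δ) / d ≤ w := by
      rw [hw, div_le_div_iff₀ hd0 hs0]
      have h2 := mul_le_mul_of_nonneg_right hle hs0.le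
      have h3 : δ * √(d : ℝ) ≤ δ * d := by
        gcongr
        nlinarith
      linarith
    have hw0 : 0 ≤ w := by positivity
    have h2 : β / n + β * (2 * (√((d : ℝ) - 1) + δ)) / d + 2 / n ≤ (3 * β + 2) * w := by
      rw [show β / n = β * (1 / (n : ℝ)) by ring, show 2 / (n : ℝ) = 2 * (1 / n) by ring,
        show β * (2 * (√((d : ℝ) - 1) + δ)) / d = 2 * β * ((√((d : ℝ) - 1) + δ) / d) by ring]
      nlinarith
    calc _ ≤ _ := h1
      _ ≤ k * C * ((3 * β + 2) * w) := by gcongr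
      _ ≤ k * C * ((3 * β + 2) * w) + k * w := le_add_of_nonneg_right (by positivity)
      _ = _ := by
        rw [hw]
        ring
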